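/- For nonnegative integers $K \le P$ write $\theta = (K,P)$. Let $K_1(\theta),\dots,K_n(\theta)$ be independent random subsets of a set of $P$ keys, each uniformly distributed over the subsets with exactly $K$ elements. The random key graph $\mathbb{K}(n;\theta)$ has vertex set $\{1,\dots,n\}$, and distinct vertices $i,j$ are adjacent if and only if $K_i(\theta)\cap K_j(\theta)\neq\emptyset$. Let $T(n,\theta)$ be the event that $\mathbb{K}(n;\theta)$ contains at least one triangle, and put $$q(\theta) = \begin{cases} 0 & \text{if } P<2K,\\ \binom{P-K}{K}\big/\binom{P}{K} & \text{if } 2K\le P,\end{cases} \qquad \tau(\theta) = \frac{K^3}{P^2} + \left(\frac{K^2}{P}\right)^3$$ (with $\tau(\theta)=0$ if $P=0$); here $q(\theta)$ is the probability that two given nodes share no key. Theorem. Let $\theta_n=(K_n,P_n)$ be a sequence of pairs of nonnegative integers with $K_n\le P_n$ for all $n\ge 2$, such that the limit $q^\star=\lim_{n\to\infty} q(\theta_n)$ exists. If either $q^\star<1$, or $q^\star=1$ and $\lim_{n\to\infty} n^3\tau(\theta_n)=\infty$, then $$\lim_{n\to\infty}\mathbb{P}[T(n,\theta_n)] = 1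 .$$ -/

import Mathlib

open MeasureTheory ProbabilityTheory Filter Topology

namespace RandomKeyGraph

/-- A scaling: a pair of functions `K, P` (key ring size and key pool size) with
`K n ≤ P n` for `n = 2, 3, …`. -/
def IsScaling (K P : ℕ → ℕ) : Prop :=
  ∀ n : ℕ, 2 ≤ n → K n ≤ P n

/-- `q(θ)` for `θ = (K, P)`, the probability that two given nodes share no key. -/
noncomputable def q (K P : ℕ) : ℝ :=
  if P < 2 * K then 0 else ((P - K).choose K : ℝ) / (P.choose K : ℝ)

/-- `τ(θ) = K³/P² + (K²/P)³` for `θ = (K, P)`. -/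
noncomputable def tau (K P : ℕ) : ℝ :=
  (K : ℝ) ^ 3 / (P : ℝ) ^ 2 + ((K : ℝ) ^ 2 / (P : ℝ)) ^ 3

/-- `ring 0, …, ring (n - 1)` are the random key rings of the `n` nodes for the parameter
`θ = (K, P)`: independent random subsets of the key pool `{0, …, P - 1}`, each one uniformly
distributed over the subsets with exactly `K` elements. The finite type of all subsets of the
pool carries the discrete σ-algebra `⊤`. -/
structure IsKeyRings {Ω : Type*} [MeasurableSpace Ω] (μ : Measure Ω) (n K P : ℕ)
    (ring : Fin n → Ω → Finset (Fin P)) : Prop where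
  measurable : ∀ i, Measurable[_, ⊤] (ring i)
  indep : iIndepFun (m := fun _ => ⊤) ring μ
  uniform : ∀ (i : Fin n) (S : Finset (Fin P)), S.card = K →
    μ.real {ω | ring i ω = S} = ((P.choose K : ℕ) : ℝ)⁻¹

/-- The key graph of given key rings: distinct nodes are adjacent if and only if they share at
least one key. -/
def keyGraph {n P : ℕ} (R : Fin n → Finset (Fin P)) : SimpleGraph (Fin n) where
  Adj i j := i ≠ j ∧ (R i ∩ R j).Nonempty
  symm := ⟨fun i j h => ⟨h.1.symm, by rw [Finset.inter_comm]; exact h.2⟩⟩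
  loopless := ⟨fun _ h => h.1 rfl⟩

/-- The number of (unlabelled) triangles, i.e. of cliques with three vertices, in a graph on
`n` nodes. -/
noncomputable def triangleCount {n : ℕ} (G : SimpleGraph (Fin n)) : ℕ :=
  (G.cliqueSet 3).ncard

/-- The event that there is at least one triangle in the random key graph. -/
def triangleEvent {Ω : Type*} {n P : ℕ} (ring : Fin n → Ω → Finset (Fin P)) : Set Ω :=
  {ω | 0 < triangleCount (keyGraph fun i => ring i ω)}

end RandomKeyGraph

/-! ### Binomial estimates: `q`, `missTwo` and the triangle probability. -/

namespace RandomKeyGraph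

open scoped BigOperators
open Finset

/-! The proof is the second moment method for the number X of triangles. Write β = `triangleProb K
P`, ρ = `twoTriangleProb K P` and l = K²/P. By symmetry of the key pool, a triangle has probability
β even when the ring of one of its nodes is given. Hence triangles sharing at most one node are
uncorrelated, and only equal triples and triples with a common edge contribute to the variance
bound. Chebyshev's inequality gives P(X = 0) ≤ 162/(n³β) + 486ρ/(n²β²).

If q⋆ < 1, then β ≥ (1 - q)³ stays away from zero and ρ ≤ 1 suffices. If q⋆ = 1, then eventually l ≤
1. Now β ≥ τ/16 (`tau_le_triangleProb`): the terms of τ reflect the two ways to close a triangle,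
one key common to all three rings (K³/P²) or three separate coincidences (l³). Moreover ρl ≤ 4τ²
(`twoTriangleProb_mul_le`) and τ ≤ 2l² (`tau_le`), so the second error term is of order 1/(n²l),
where n²l ≥ √(n³τ/2).

Moments are computed as finite averages `𝔼` over families of rings; the measure enters through
`one_sub_le_measureReal_triangleEvent`. -/

theorem cast_choose_mul_factorial {m K : ℕ} (h : K ≤ m) :
    (m.choose K : ℝ) * (K.factorial : ℝ) = ∏ i ∈ range K, ((m : ℝ) - i) := by
  rw [mul_comm, ← Nat.cast_mul, ← Nat.descFactorial_eq_factorial_mul_choose,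
    Nat.descFactorial_eq_prod_range, Nat.cast_prod]
  refine prod_congr rfl fun i hi => ?_
  rw [Nat.cast_sub ((mem_range.1 hi).le.trans h)]

/-- Factor by factor, (P-2k-i)(P-i) = (P-k-i)² - k², and (P-k-i)² ≤ P² makes the loss k² a relative
one. The case k = K bounds `missTwo`; k = 1 gives the negative correlation of two keys. -/
theorem choose_sub_two_mul_mul_choose_le {P K k : ℕ} (hk : k ≤ P) :
    ((P - 2 * k).choose K : ℝ) * (P.choose K : ℝ) ≤
      ((P - k).choose K : ℝ) ^ 2 * (1 - (k : ℝ) ^ 2 / (P : ℝ) ^ 2) ^ K := by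
  have hfac : 0 ≤ 1 - (k : ℝ) ^ 2 / (P : ℝ) ^ 2 := by
    rw [← div_pow, sub_nonneg]
    exact pow_le_one₀ (by positivity) (div_le_one_of_le₀ (by exact_mod_cast hk) (by positivity))
  rcases Nat.eq_zero_or_pos K with rfl | hK
  · simp
  by_cases h : P - 2 * k < K
  · rw [Nat.choose_eq_zero_of_lt h]
    simp only [Nat.cast_zero, zero_mul]
    positivity
  have h1 : 2 * k + K ≤ P := by omega
  have h1' : 2 * (k : ℝ) + K ≤ P := by exact_mod_cast h1
  have hf : (0 : ℝ) < (K.factorial : ℝ) ^ 2 := by positivity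
  have hP : (0 : ℝ) < P := by
    have : 0 < P := by omega
    exact_mod_cast this
  refine le_of_mul_le_mul_right ?_ hf
  calc ((P - 2 * k).choose K : ℝ) * (P.choose K : ℝ) * (K.factorial : ℝ) ^ 2
      = (((P - 2 * k).choose K : ℝ) * K.factorial) * ((P.choose K : ℝ) * K.factorial) := by ring
    _ = ∏ i ∈ range K, ((((P - 2 * k : ℕ) : ℝ) - i) * ((P : ℝ) - i)) := by
        rw [cast_choose_mul_factorial (by omega), cast_choose_mul_factorial (by omega),
          prod_mul_distrib]
    _ ≤ ∏ i ∈ range K, ((((P - k : ℕ) : ℝ) - i) ^ 2 * (1 - (k : ℝ) ^ 2 / (P : ℝ) ^ 2)) := by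
        refine prod_le_prod (fun i hi => ?_) (fun i hi => ?_) <;>
          have hi' : (i : ℝ) + 1 ≤ K := by exact_mod_cast mem_range.1 hi
        · rw [Nat.cast_sub (by omega)]
          push_cast
          exact mul_nonneg (by linarith) (by have : (0 : ℝ) ≤ k := by positivity
                                             linarith)
        · rw [Nat.cast_sub (by omega), Nat.cast_sub (by omega)]
          push_cast
          have hk0 : (0 : ℝ) ≤ k := by positivity
          have hi0 : (0 : ℝ) ≤ i := by positivity
          have h2 : ((P : ℝ) - k - i) ^ 2 ≤ (P : ℝ) ^ 2 :=
            pow_le_pow_left₀ (by linarith) (by linarith) 2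
          have h3 : ((P : ℝ) - k - i) ^ 2 * ((k : ℝ) ^ 2 / (P : ℝ) ^ 2) ≤ (k : ℝ) ^ 2 := by
            rw [mul_div_assoc', div_le_iff₀ (by positivity), mul_comm]
            exact mul_le_mul_of_nonneg_left h2 (by positivity)
          linarith [show ((P : ℝ) - 2 * k - i) * (P - i) = (P - k - i) ^ 2 - (k : ℝ) ^ 2 by ring]
    _ = (((P - k).choose K : ℝ) * K.factorial) ^ 2 * (1 - (k : ℝ) ^ 2 / (P : ℝ) ^ 2) ^ K := by
        rw [cast_choose_mul_factorial (by omega), prod_mul_distrib, prod_pow, prod_const,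
          card_range]
    _ = _ := by ring

theorem q_eq {K P : ℕ} (h : K ≤ P) : q K P = ((P - K).choose K : ℝ) / (P.choose K : ℝ) := by
  unfold q
  split_ifs with h'
  · rw [Nat.choose_eq_zero_of_lt (by omega)]; simp
  · rfl

theorem cast_choose_pos {K P : ℕ} (h : K ≤ P) : (0 : ℝ) < P.choose K := by
  exact_mod_cast Nat.choose_pos h

theorem q_nonneg (K P : ℕ) : 0 ≤ q K P := by
  unfold q; split_ifs <;> positivity

theorem q_le_one {K P : ℕ} (h : K ≤ P) : q K P ≤ 1 := by
  rw [q_eq h, div_le_one (cast_choose_pos h)]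
  exact_mod_cast Nat.choose_le_choose K (Nat.sub_le P K)

/-- Each ratio (P-K-i)/(P-i) is at most 1 - K/P ≤ exp(-K/P), and there are K of them. -/
theorem q_le_exp {K P : ℕ} (h : K ≤ P) : q K P ≤ Real.exp (-((K : ℝ) ^ 2 / P)) := by
  by_cases h2 : P < 2 * K
  · rw [q, if_pos h2]; positivity
  push Not at h2
  rcases Nat.eq_zero_or_pos K with rfl | hK
  · simp [q]
  have hP : (0 : ℝ) < P := by
    have : 0 < P := by omega
    exact_mod_cast this
  have h2' : 2 * (K : ℝ) ≤ P := by exact_mod_cast h2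
  have hf : (0 : ℝ) < (K.factorial : ℝ) := by positivity
  have key : q K P ≤ (1 - (K : ℝ) / P) ^ K := by
    rw [q_eq h, div_le_iff₀ (cast_choose_pos h)]
    refine le_of_mul_le_mul_right ?_ hf
    rw [mul_assoc, cast_choose_mul_factorial (by omega), cast_choose_mul_factorial h]
    rw [show (1 - (K : ℝ) / P) ^ K = ∏ _i ∈ range K, (1 - (K : ℝ) / P) by simp,
      ← prod_mul_distrib]
    refine prod_le_prod (fun i hi => ?_) (fun i hi => ?_) <;>
      have hi' : (i : ℝ) + 1 ≤ K := by exact_mod_cast mem_range.1 hi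
    · rw [Nat.cast_sub h]; linarith
    · rw [Nat.cast_sub h]
      have h4 : (K : ℝ) / P * P = K := div_mul_cancel₀ _ hP.ne'
      have h5 : (0 : ℝ) ≤ K / P * i := by positivity
      linarith [show (1 - (K : ℝ) / P) * (P - i) = P - K / P * P - i + K / P * i by ring]
  refine key.trans ?_
  calc (1 - (K : ℝ) / P) ^ K ≤ Real.exp (-((K : ℝ) / P)) ^ K := by
        refine pow_le_pow_left₀ ?_ (Real.one_sub_le_exp_neg _) K
        rw [sub_nonneg, div_le_one hP]
        exact_mod_cast h
    _ = Real.exp (-((K : ℝ) ^ 2 / P)) := by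
        rw [← Real.exp_nat_mul]; congr 1; ring

/-- The probability that a random key ring misses the union of two disjoint key rings. -/
noncomputable def missTwo (K P : ℕ) : ℝ := ((P - 2 * K).choose K : ℝ) / (P.choose K : ℝ)

/-- The probability that three given nodes form a triangle. -/
noncomputable def triangleProb (K P : ℕ) : ℝ :=
  1 - 3 * q K P + 3 * q K P ^ 2 - q K P * missTwo K P

theorem missTwo_le {K P : ℕ} (h : K ≤ P) :
    missTwo K P ≤ q K P ^ 2 * Real.exp (-((K : ℝ) ^ 3 / (P : ℝ) ^ 2)) := by
  have hN := cast_choose_pos h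
  have h0 : missTwo K P ≤ q K P ^ 2 * (1 - (K : ℝ) ^ 2 / (P : ℝ) ^ 2) ^ K := by
    rw [missTwo, q_eq h, div_pow, div_mul_eq_mul_div, div_le_div_iff₀ hN (by positivity)]
    have := mul_le_mul_of_nonneg_right (choose_sub_two_mul_mul_choose_le (K := K) h) hN.le
    linarith
  refine h0.trans (mul_le_mul_of_nonneg_left ?_ (by positivity))
  calc (1 - (K : ℝ) ^ 2 / (P : ℝ) ^ 2) ^ K ≤ Real.exp (-((K : ℝ) ^ 2 / (P : ℝ) ^ 2)) ^ K := by
        refine pow_le_pow_left₀ ?_ (Real.one_sub_le_exp_neg _) K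
        rw [← div_pow, sub_nonneg]
        exact pow_le_one₀ (by positivity)
          (div_le_one_of_le₀ (by exact_mod_cast h) (by positivity))
    _ = _ := by
        rw [← Real.exp_nat_mul]; congr 1; ring

/-- With r = `missTwo K P`, the triangle probability equals (1-q)³ + q(q² - r), and `missTwo_le`
bounds q² - r from below. -/
theorem le_triangleProb {K P : ℕ} (h : K ≤ P) :
    (1 - q K P) ^ 3 + q K P ^ 3 * (1 - Real.exp (-((K : ℝ) ^ 3 / (P : ℝ) ^ 2))) ≤
      triangleProb K P := by
  have := mul_le_mul_of_nonneg_left (missTwo_le h) (q_nonneg K P)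
  rw [triangleProb]
  linarith [show (1 - q K P) ^ 3 = 1 - 3 * q K P + 3 * q K P ^ 2 - q K P ^ 3 by ring,
    show q K P * (q K P ^ 2 * Real.exp (-((K : ℝ) ^ 3 / (P : ℝ) ^ 2))) =
      q K P ^ 3 * Real.exp (-((K : ℝ) ^ 3 / (P : ℝ) ^ 2)) by ring]

theorem one_sub_q_pow_le_triangleProb {K P : ℕ} (h : K ≤ P) :
    (1 - q K P) ^ 3 ≤ triangleProb K P := by
  refine le_trans (le_add_of_nonneg_right ?_) (le_triangleProb h)
  refine mul_nonneg (pow_nonneg (q_nonneg K P) 3) (sub_nonneg.2 (Real.exp_le_one_iff.2 ?_))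
  rw [neg_nonpos]; positivity

end RandomKeyGraph

/-! ### Averages over single key rings. -/

namespace RandomKeyGraph

open scoped BigOperators
open Finset

/-- The possible key rings: the subsets of the key pool with exactly `K` elements. -/
abbrev keyRings (K P : ℕ) : Finset (Finset (Fin P)) := powersetCard K univ

/-- The indicator that two key rings share no key. -/
noncomputable def miss {P : ℕ} (A B : Finset (Fin P)) : ℝ := if Disjoint A B then 1 else 0

/-- The indicator that two key rings share a key. -/
noncomputable def meet {P : ℕ} (A B : Finset (Fin P)) : ℝ := 1 - miss A B

variable {K P : ℕ}

theorem miss_mul_self (A B : Finset (Fin P)) : miss A B * miss A B = miss A B := by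
  unfold miss; split_ifs <;> simp

theorem meet_mul_self (A B : Finset (Fin P)) : meet A B * meet A B = meet A B := by
  unfold meet; linear_combination miss_mul_self A B

theorem miss_comm (A B : Finset (Fin P)) : miss A B = miss B A := by
  simp only [miss, disjoint_comm]

theorem meet_nonneg (A B : Finset (Fin P)) : 0 ≤ meet A B := by
  unfold meet miss; split_ifs <;> simp

theorem meet_le_one (A B : Finset (Fin P)) : meet A B ≤ 1 := by
  unfold meet miss; split_ifs <;> simp

theorem meet_le_card_inter (A B : Finset (Fin P)) : meet A B ≤ (#(A ∩ B) : ℝ) := by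
  unfold meet miss
  split_ifs with h
  · simp
  · rw [disjoint_iff_inter_eq_empty, ← Ne, ← nonempty_iff_ne_empty, ← card_pos] at h
    have : (1 : ℝ) ≤ (#(A ∩ B) : ℝ) := by exact_mod_cast h
    simpa using this

theorem miss_mul_miss (A B C : Finset (Fin P)) : miss A C * miss B C = miss (A ∪ B) C := by
  unfold miss
  by_cases h1 : Disjoint A C <;> by_cases h2 : Disjoint B C <;> simp [disjoint_union_left, h1, h2]

theorem keyRings_nonempty (h : K ≤ P) : (keyRings K P).Nonempty := by
  rw [powersetCard_nonempty]; simpa using h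

theorem card_keyRings : #(keyRings K P) = P.choose K := by simp

theorem expect_miss (A : Finset (Fin P)) :
    𝔼 S ∈ keyRings K P, miss A S = ((P - #A).choose K : ℝ) / (P.choose K : ℝ) := by
  rw [expect_eq_sum_div_card, card_keyRings]
  congr 1
  unfold miss
  rw [sum_boole]
  have : (keyRings K P).filter (fun S => Disjoint A S) = powersetCard K Aᶜ := by
    ext S
    simp only [mem_filter, mem_powersetCard, subset_univ, true_and, and_comm,
      subset_compl_iff_disjoint_left]
  rw [this, card_powersetCard, card_compl, Fintype.card_fin]

theorem expect_miss_of_mem (h : K ≤ P) {A : Finset (Fin P)} (hA : A ∈ keyRings K P) :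
    𝔼 S ∈ keyRings K P, miss A S = q K P := by
  rw [expect_miss, (mem_powersetCard.1 hA).2, q_eq h]

theorem expect_miss_of_mem' (h : K ≤ P) {A : Finset (Fin P)} (hA : A ∈ keyRings K P) :
    𝔼 S ∈ keyRings K P, miss S A = q K P := by
  simp_rw [miss_comm _ A]; exact expect_miss_of_mem h hA

theorem expect_miss_mul_miss_mul_miss (h : K ≤ P) {A : Finset (Fin P)} (hA : A ∈ keyRings K P) :
    𝔼 B ∈ keyRings K P, 𝔼 C ∈ keyRings K P, miss A B * (miss A C * miss B C) =
      q K P * missTwo K P := by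
  rw [← expect_miss_of_mem h hA, expect_mul]
  refine expect_congr rfl fun B hB => ?_
  rw [← mul_expect]
  -- For disjoint `A` and `B`, the ring `C` has to miss a union of exactly 2K keys; otherwise the
  -- factor `miss A B` vanishes.
  by_cases hd : Disjoint A B
  · simp_rw [miss_mul_miss]
    rw [expect_miss, card_union_of_disjoint hd, (mem_powersetCard.1 hA).2,
      (mem_powersetCard.1 hB).2, missTwo, two_mul]
  · simp [miss, hd]

/-- Given the key ring of one of them, three nodes form a triangle with probability
`triangleProb K P`. -/
theorem expect_triangle (h : K ≤ P) {A : Finset (Fin P)} (hA : A ∈ keyRings K P) :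
    𝔼 B ∈ keyRings K P, 𝔼 C ∈ keyRings K P, meet A B * meet A C * meet B C =
      triangleProb K P := by
  have hne := keyRings_nonempty h
  -- Inclusion–exclusion. Products of at most two misses run along a path and factor into powers of
  -- q; only the triple product needs `missTwo`.
  have e : ∀ B C : Finset (Fin P), meet A B * meet A C * meet B C =
      (1 - miss A B) - (1 - miss A B) * miss A C - miss B C + miss A B * miss B C +
        miss A C * miss B C - miss A B * (miss A C * miss B C) := fun B C => by
    unfold meet; ring
  simp_rw [e, expect_sub_distrib, expect_add_distrib, expect_sub_distrib]
  rw [expect_miss_mul_miss_mul_miss h hA]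
  have e1 : 𝔼 B ∈ keyRings K P, 𝔼 C ∈ keyRings K P, miss B C = q K P := by
    rw [expect_congr rfl fun B hB => expect_miss_of_mem h hB, expect_const hne]
  have e2 : 𝔼 B ∈ keyRings K P, 𝔼 C ∈ keyRings K P, miss A B * miss B C = q K P * q K P := by
    rw [expect_congr rfl fun B hB => by rw [← mul_expect, expect_miss_of_mem h hB],
      ← expect_mul, expect_miss_of_mem h hA]
  have e3 : 𝔼 B ∈ keyRings K P, 𝔼 C ∈ keyRings K P, miss A C * miss B C = q K P * q K P := by
    rw [expect_comm, expect_congr rfl fun B hB => by rw [← mul_expect, expect_miss_of_mem' h hB],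
      ← expect_mul, expect_miss_of_mem h hA]
  have e4 : 𝔼 B ∈ keyRings K P, 𝔼 C ∈ keyRings K P, (1 - miss A B) * miss A C =
      (1 - q K P) * q K P := by
    rw [expect_congr rfl fun B hB => by rw [← mul_expect, expect_miss_of_mem h hA],
      ← expect_mul, expect_sub_distrib, expect_miss_of_mem h hA, expect_const hne]
  rw [e1, e2, e3, e4]
  simp_rw [expect_const hne]
  rw [expect_miss_of_mem h hA, triangleProb]
  ring

/-! ### Key overlaps and pairs of triangles with a common edge. -/

/-- The indicator that a key belongs to a key ring. -/
noncomputable def holds (x : Fin P) (A : Finset (Fin P)) : ℝ := 1 - miss {x} A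

theorem holds_eq (x : Fin P) (A : Finset (Fin P)) : holds x A = if x ∈ A then 1 else 0 := by
  unfold holds miss
  by_cases h : x ∈ A <;> simp [h]

theorem holds_mul_self (x : Fin P) (A : Finset (Fin P)) : holds x A * holds x A = holds x A := by
  rw [holds_eq]; split_ifs <;> simp

theorem choose_pred_div (h : K ≤ P) (hP : 0 < P) :
    ((P - 1).choose K : ℝ) / (P.choose K : ℝ) = 1 - (K : ℝ) / P := by
  obtain ⟨m, rfl⟩ : ∃ m, P = m + 1 := ⟨P - 1, by omega⟩
  have := Nat.choose_mul_succ_eq m K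
  have h2 : (m.choose K : ℝ) * ((m + 1 : ℕ) : ℝ) =
      ((m + 1).choose K : ℝ) * (((m + 1 : ℕ) : ℝ) - K) := by
    rw [← Nat.cast_sub h]; exact_mod_cast this
  have hm : ((m + 1 : ℕ) : ℝ) ≠ 0 := by positivity
  rw [div_eq_iff (cast_choose_pos h).ne', Nat.add_sub_cancel]
  field_simp
  linear_combination h2

theorem expect_holds (h : K ≤ P) (x : Fin P) : 𝔼 S ∈ keyRings K P, holds x S = (K : ℝ) / P := by
  unfold holds
  rw [expect_sub_distrib, expect_const (keyRings_nonempty h), expect_miss, card_singleton,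
    choose_pred_div h x.pos]
  ring

/-- Negative correlation in sampling without replacement. Inclusion–exclusion reduces it to the
probability of missing both keys. -/
theorem expect_holds_mul_holds_le (h : K ≤ P) {x y : Fin P} (hxy : x ≠ y) :
    𝔼 S ∈ keyRings K P, holds x S * holds y S ≤ ((K : ℝ) / P) ^ 2 := by
  have e : ∀ S : Finset (Fin P), holds x S * holds y S =
      holds x S + holds y S - 1 + miss ({x} ∪ {y}) S := fun S => by
    rw [← miss_mul_miss]; unfold holds; ring
  have hN := cast_choose_pos h
  have key : ((P - 2).choose K : ℝ) / (P.choose K : ℝ) ≤ (1 - (K : ℝ) / P) ^ 2 := by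
    rw [← choose_pred_div h x.pos, div_pow, div_le_div_iff₀ hN (by positivity)]
    have h1 := choose_sub_two_mul_mul_choose_le (K := K) (k := 1) (P := P) x.pos
    have hP : (1 : ℝ) ≤ P := by exact_mod_cast x.pos
    have h2 : (1 - ((1 : ℕ) : ℝ) ^ 2 / (P : ℝ) ^ 2) ^ K ≤ 1 := by
      refine pow_le_one₀ ?_ (sub_le_self _ (by positivity))
      rw [sub_nonneg, Nat.cast_one, one_pow]
      exact div_le_one_of_le₀ (one_le_pow₀ hP) (by positivity)
    have h3 := mul_le_mul_of_nonneg_right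
      (h1.trans (mul_le_of_le_one_right (by positivity) h2)) hN.le
    linarith
  simp_rw [e, expect_add_distrib, expect_sub_distrib, expect_add_distrib]
  rw [expect_holds h, expect_holds h, expect_const (keyRings_nonempty h), expect_miss,
    card_union_of_disjoint (by simpa using hxy), card_singleton, card_singleton]
  linarith [show (1 - (K : ℝ) / P) ^ 2 = 1 - 2 * (K / P) + ((K : ℝ) / P) ^ 2 by ring]

theorem card_inter_eq_sum_holds (A B : Finset (Fin P)) :
    (#(A ∩ B) : ℝ) = ∑ x ∈ A, holds x B := by
  simp_rw [holds_eq]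
  rw [sum_boole, filter_mem_eq_inter]

theorem expect_card_inter (h : K ≤ P) {A : Finset (Fin P)} (hA : A ∈ keyRings K P) :
    𝔼 B ∈ keyRings K P, (#(A ∩ B) : ℝ) = (K : ℝ) ^ 2 / P := by
  simp_rw [card_inter_eq_sum_holds]
  rw [expect_sum_comm, sum_congr rfl fun x _ => expect_holds h x, sum_const,
    (mem_powersetCard.1 hA).2, nsmul_eq_mul]
  ring

theorem expect_card_inter_sq_le (h : K ≤ P) {A : Finset (Fin P)} (hA : A ∈ keyRings K P) :
    𝔼 B ∈ keyRings K P, (#(A ∩ B) : ℝ) ^ 2 ≤ (K : ℝ) ^ 2 / P + ((K : ℝ) ^ 2 / P) ^ 2 := by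
  have hc := (mem_powersetCard.1 hA).2
  simp_rw [card_inter_eq_sum_holds, sq, sum_mul_sum]
  rw [expect_sum_comm]
  calc ∑ x ∈ A, 𝔼 B ∈ keyRings K P, ∑ y ∈ A, holds x B * holds y B
      ≤ ∑ x ∈ A, ((K : ℝ) / P + K * ((K : ℝ) / P) ^ 2) := by
        refine sum_le_sum fun x hx => ?_
        rw [expect_sum_comm, ← add_sum_erase A _ hx]
        refine add_le_add ?_ ?_
        · simp_rw [holds_mul_self]; exact (expect_holds h x).le
        · refine (sum_le_sum fun y hy =>
            expect_holds_mul_holds_le h (ne_of_mem_erase hy).symm).trans ?_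
          rw [sum_const, nsmul_eq_mul]
          refine mul_le_mul_of_nonneg_right ?_ (by positivity)
          rw [← hc]; exact_mod_cast card_erase_le
    _ = _ := by rw [sum_const, hc, nsmul_eq_mul]; ring

/-- Union bound over pairs x ∈ A, y ∈ B of keys held by `C`. The diagonal x = y runs over A ∩ B with
weight K/P; the K² pairs contribute at most (K/P)² each. -/
theorem expect_meet_mul_meet_le (h : K ≤ P) {A B : Finset (Fin P)} (hA : A ∈ keyRings K P)
    (hB : B ∈ keyRings K P) :
    𝔼 C ∈ keyRings K P, meet A C * meet B C ≤
      #(A ∩ B) * ((K : ℝ) / P) + ((K : ℝ) ^ 2 / P) ^ 2 := by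
  have hcA := (mem_powersetCard.1 hA).2
  have hcB := (mem_powersetCard.1 hB).2
  have pt : ∀ C : Finset (Fin P), meet A C * meet B C ≤
      ∑ x ∈ A, ∑ y ∈ B, holds x C * holds y C := fun C => by
    rw [← sum_mul_sum, ← card_inter_eq_sum_holds, ← card_inter_eq_sum_holds]
    exact mul_le_mul (meet_le_card_inter _ _) (meet_le_card_inter _ _) (meet_nonneg _ _)
      (by positivity)
  refine (expect_le_expect fun C _ => pt C).trans ?_
  rw [expect_sum_comm]
  simp_rw [expect_sum_comm]
  calc ∑ x ∈ A, ∑ y ∈ B, 𝔼 C ∈ keyRings K P, holds x C * holds y C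
      ≤ ∑ x ∈ A, ∑ y ∈ B, ((if x = y then (K : ℝ) / P else 0) + ((K : ℝ) / P) ^ 2) := by
        refine sum_le_sum fun x _ => sum_le_sum fun y _ => ?_
        split_ifs with hxy
        · subst hxy
          simp_rw [holds_mul_self]
          rw [expect_holds h]
          exact le_add_of_nonneg_right (by positivity)
        · rw [zero_add]; exact expect_holds_mul_holds_le h hxy
    _ = _ := by
        simp_rw [sum_add_distrib, sum_ite_eq, sum_const, hcB, hcA]
        rw [← sum_filter, filter_mem_eq_inter, sum_const, nsmul_eq_mul, nsmul_eq_mul,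
          nsmul_eq_mul]
        ring

/-- The probability that two triangles sharing two nodes are both present. -/
noncomputable def twoTriangleProb (K P : ℕ) : ℝ :=
  𝔼 A ∈ keyRings K P, 𝔼 B ∈ keyRings K P,
    meet A B * (𝔼 C ∈ keyRings K P, meet A C * meet B C) ^ 2

theorem expect_meet_mul_meet_nonneg (A B : Finset (Fin P)) :
    0 ≤ 𝔼 C ∈ keyRings K P, meet A C * meet B C :=
  expect_nonneg fun _ _ => mul_nonneg (meet_nonneg _ _) (meet_nonneg _ _)

theorem twoTriangleProb_le_one (h : K ≤ P) : twoTriangleProb K P ≤ 1 := by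
  have hne := keyRings_nonempty h
  refine expect_le hne fun A _ => expect_le hne fun B _ => ?_
  refine mul_le_one₀ (meet_le_one _ _) (by positivity) (pow_le_one₀
    (expect_meet_mul_meet_nonneg A B) (expect_le hne fun C _ => ?_))
  exact mul_le_one₀ (meet_le_one _ _) (meet_nonneg _ _) (meet_le_one _ _)

theorem twoTriangleProb_le (h : K ≤ P) :
    twoTriangleProb K P ≤
      2 * ((K : ℝ) / P) ^ 2 * ((K : ℝ) ^ 2 / P + ((K : ℝ) ^ 2 / P) ^ 2) +
        2 * ((K : ℝ) ^ 2 / P) ^ 5 := by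
  refine expect_le (keyRings_nonempty h) fun A hA => ?_
  have pt : ∀ B ∈ keyRings K P, meet A B * (𝔼 C ∈ keyRings K P, meet A C * meet B C) ^ 2 ≤
      2 * ((K : ℝ) / P) ^ 2 * (#(A ∩ B) : ℝ) ^ 2 +
        2 * ((K : ℝ) ^ 2 / P) ^ 4 * (#(A ∩ B) : ℝ) := fun B hB => by
    have h1 := pow_le_pow_left₀ (expect_meet_mul_meet_nonneg A B)
      (expect_meet_mul_meet_le h hA hB) 2
    have h2 := add_sq_le (a := #(A ∩ B) * ((K : ℝ) / P)) (b := ((K : ℝ) ^ 2 / P) ^ 2)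
    have h3 := mul_le_mul_of_nonneg_left (h1.trans h2) (meet_nonneg A B)
    refine h3.trans ?_
    -- The indicator is dropped where |A ∩ B|² is already present, and bounded by |A ∩ B| in the
    -- other term, which gains a factor K²/P on averaging.
    have h4 := mul_le_mul_of_nonneg_right (meet_le_one A B)
      (show 0 ≤ 2 * (#(A ∩ B) * ((K : ℝ) / P)) ^ 2 by positivity)
    have h5 := mul_le_mul_of_nonneg_right (meet_le_card_inter A B)
      (show 0 ≤ 2 * (((K : ℝ) ^ 2 / P) ^ 2) ^ 2 by positivity)
    linarith
  refine (expect_le_expect pt).trans ?_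
  rw [expect_add_distrib, ← mul_expect, ← mul_expect, expect_card_inter h hA]
  have := mul_le_mul_of_nonneg_left (expect_card_inter_sq_le h hA)
    (show 0 ≤ 2 * ((K : ℝ) / P) ^ 2 by positivity)
  linarith

end RandomKeyGraph

/-! ### Families of rings and the second moment of the triangle count. -/

namespace RandomKeyGraph

open scoped BigOperators
open Finset

variable {K P : ℕ}

/-- The possible families of key rings of `n` nodes. -/
abbrev keyRingFamilies (n K P : ℕ) : Finset (Fin n → Finset (Fin P)) :=
  Fintype.piFinset fun _ => keyRings K P

variable {n : ℕ}

theorem keyRingFamilies_nonempty (h : K ≤ P) : (keyRingFamilies n K P).Nonempty :=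
  Fintype.piFinset_nonempty.2 fun _ => keyRings_nonempty h

theorem update_mem_keyRingFamilies {A : Fin n → Finset (Fin P)} (hA : A ∈ keyRingFamilies n K P)
    (j : Fin n) {S : Finset (Fin P)} (hS : S ∈ keyRings K P) :
    Function.update A j S ∈ keyRingFamilies n K P := by
  rw [Fintype.mem_piFinset] at hA ⊢
  intro i
  by_cases hij : i = j
  · subst hij; rwa [Function.update_self]
  · rw [Function.update_of_ne hij]; exact hA i

/-- Resampling the key ring of one node does not change an expectation. -/
theorem expect_update (h : K ≤ P) (j : Fin n) (F : (Fin n → Finset (Fin P)) → ℝ) :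
    𝔼 A ∈ keyRingFamilies n K P, 𝔼 S ∈ keyRings K P, F (Function.update A j S) =
      𝔼 A ∈ keyRingFamilies n K P, F A := by
  have e1 : 𝔼 p ∈ keyRingFamilies n K P ×ˢ keyRings K P, F (Function.update p.1 j p.2) =
      𝔼 p ∈ keyRingFamilies n K P ×ˢ keyRings K P, F p.1 := by
    -- Exchanging the new ring with the ring of `j` is an involution on pairs (family, ring).
    refine expect_nbij' (fun p => (Function.update p.1 j p.2, p.1 j))
      (fun p => (Function.update p.1 j p.2, p.1 j)) ?_ ?_ ?_ ?_ ?_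
    · intro p hp
      rw [mem_product] at hp ⊢
      exact ⟨update_mem_keyRingFamilies hp.1 j hp.2, Fintype.mem_piFinset.1 hp.1 j⟩
    · intro p hp
      rw [mem_product] at hp ⊢
      exact ⟨update_mem_keyRingFamilies hp.1 j hp.2, Fintype.mem_piFinset.1 hp.1 j⟩
    · intro p _; simp
    · intro p _; simp
    · intro p _; rfl
  rw [expect_product, expect_product] at e1
  rw [e1]
  exact expect_congr rfl fun A _ => expect_const (keyRings_nonempty h) (F A)

open scoped Classical in
/-- The indicator that a set of nodes spans a triangle. -/
noncomputable def triangle (s : Finset (Fin n)) (A : Fin n → Finset (Fin P)) : ℝ :=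
  if (keyGraph A).IsNClique 3 s then 1 else 0

theorem triangle_mul_self (s : Finset (Fin n)) (A : Fin n → Finset (Fin P)) :
    triangle s A * triangle s A = triangle s A := by
  unfold triangle; split_ifs <;> simp

open scoped Classical in
theorem meet_eq_ite_adj (A : Fin n → Finset (Fin P)) {a b : Fin n} (hab : a ≠ b) :
    meet (A a) (A b) = if (keyGraph A).Adj a b then 1 else 0 := by
  have : (keyGraph A).Adj a b ↔ ¬ Disjoint (A a) (A b) := by
    rw [not_disjoint_iff_nonempty_inter]
    exact ⟨fun h => h.2, fun h => ⟨hab, h⟩⟩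
  unfold meet miss
  by_cases hd : Disjoint (A a) (A b) <;> simp [this, hd]

theorem triangle_eq (A : Fin n → Finset (Fin P)) {a b c : Fin n} (hab : a ≠ b) (hac : a ≠ c)
    (hbc : b ≠ c) :
    triangle {a, b, c} A = meet (A a) (A b) * meet (A a) (A c) * meet (A b) (A c) := by
  classical
  rw [meet_eq_ite_adj A hab, meet_eq_ite_adj A hac, meet_eq_ite_adj A hbc, triangle]
  simp only [SimpleGraph.is3Clique_triple_iff]
  by_cases h1 : (keyGraph A).Adj a b <;> by_cases h2 : (keyGraph A).Adj a c <;>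
    by_cases h3 : (keyGraph A).Adj b c <;> simp [h1, h2, h3]

theorem triangle_update_of_notMem {t : Finset (Fin n)} (ht : #t = 3) (A : Fin n → Finset (Fin P))
    {j : Fin n} (hj : j ∉ t) (S : Finset (Fin P)) :
    triangle t (Function.update A j S) = triangle t A := by
  obtain ⟨a, b, c, hab, hac, hbc, rfl⟩ := card_eq_three.1 ht
  simp only [mem_insert, mem_singleton, not_or] at hj
  rw [triangle_eq _ hab hac hbc, triangle_eq _ hab hac hbc, Function.update_of_ne (Ne.symm hj.1),
    Function.update_of_ne (Ne.symm hj.2.1), Function.update_of_ne (Ne.symm hj.2.2)]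

/-- A triangle is uncorrelated with every function that depends on at most one of
its key rings. -/
theorem expect_triangle_mul (h : K ≤ P) {a b c : Fin n} (hab : a ≠ b) (hac : a ≠ c) (hbc : b ≠ c)
    (F : (Fin n → Finset (Fin P)) → ℝ) (hb : ∀ A S, F (Function.update A b S) = F A)
    (hc : ∀ A S, F (Function.update A c S) = F A) :
    𝔼 A ∈ keyRingFamilies n K P, triangle {a, b, c} A * F A =
      triangleProb K P * 𝔼 A ∈ keyRingFamilies n K P, F A := by
  -- Only the rings of `b` and `c` are resampled. `F` does not see them, and the inner average is
  -- constant by `expect_triangle`.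
  rw [← expect_update h c, ← expect_update h b, mul_expect]
  refine expect_congr rfl fun A hA => ?_
  rw [← expect_triangle h (Fintype.mem_piFinset.1 hA a), expect_mul]
  refine expect_congr rfl fun B _ => ?_
  rw [expect_mul]
  refine expect_congr rfl fun C _ => ?_
  rw [triangle_eq _ hab hac hbc, hc, hb]
  simp [Function.update_of_ne, hab, hac, hbc]

theorem expect_triangle_eq (h : K ≤ P) {s : Finset (Fin n)} (hs : #s = 3) :
    𝔼 A ∈ keyRingFamilies n K P, triangle s A = triangleProb K P := by
  obtain ⟨a, b, c, hab, hac, hbc, rfl⟩ := card_eq_three.1 hs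
  have := expect_triangle_mul h hab hac hbc (fun _ => 1) (fun _ _ => rfl) (fun _ _ => rfl)
  simpa [expect_const (keyRingFamilies_nonempty h)] using this

theorem expect_triangle_mul_triangle_of_card_inter_le_one (h : K ≤ P) {s t : Finset (Fin n)}
    (hs : #s = 3) (ht : #t = 3) (hst : #(s ∩ t) ≤ 1) :
    𝔼 A ∈ keyRingFamilies n K P, triangle s A * triangle t A = triangleProb K P ^ 2 := by
  obtain ⟨a, b, c, hab, hac, hbc, hs', hb, hc⟩ : ∃ a b c, a ≠ b ∧ a ≠ c ∧ b ≠ c ∧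
      s = {a, b, c} ∧ b ∉ t ∧ c ∉ t := by
    have h2 : 1 < #(s \ t) := by
      have := card_sdiff_add_card_inter s t
      omega
    obtain ⟨b, hb, c, hc, hbc⟩ := one_lt_card.1 h2
    rw [Finset.mem_sdiff] at hb hc
    have h3 : #((s.erase b).erase c) = 1 := by
      rw [card_erase_of_mem (mem_erase.2 ⟨hbc.symm, hc.1⟩), card_erase_of_mem hb.1, hs]
    obtain ⟨a, ha⟩ := card_eq_one.1 h3
    have ha' : a ∈ (s.erase b).erase c := by rw [ha]; simp
    simp only [mem_erase] at ha'
    refine ⟨a, b, c, ha'.2.1, ha'.1, hbc, ?_, hb.2, hc.2⟩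
    rw [← insert_erase hb.1, ← insert_erase (mem_erase.2 ⟨hbc.symm, hc.1⟩), ha]
    ext x; simp only [mem_insert, mem_singleton]; tauto
  subst hs'
  rw [expect_triangle_mul h hab hac hbc _ (fun A S => triangle_update_of_notMem ht A hb S)
    (fun A S => triangle_update_of_notMem ht A hc S), expect_triangle_eq h ht, sq]

theorem expect_triangle_mul_triangle_of_card_inter_eq_two (h : K ≤ P) {s t : Finset (Fin n)}
    (hs : #s = 3) (ht : #t = 3) (hst : #(s ∩ t) = 2) :
    𝔼 A ∈ keyRingFamilies n K P, triangle s A * triangle t A = twoTriangleProb K P := by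
  obtain ⟨a, b, hab, hi⟩ := card_eq_two.1 hst
  have h1 : #(s \ t) = 1 := by
    have := card_sdiff_add_card_inter s t
    omega
  have h2 : #(t \ s) = 1 := by
    have := card_sdiff_add_card_inter t s
    rw [inter_comm] at this
    omega
  obtain ⟨c, hc⟩ := card_eq_one.1 h1
  obtain ⟨d, hd⟩ := card_eq_one.1 h2
  have ha : a ∈ s ∩ t := by rw [hi]; simp
  have hb : b ∈ s ∩ t := by rw [hi]; simp
  have hc' : c ∈ s \ t := by rw [hc]; simp
  have hd' : d ∈ t \ s := by rw [hd]; simp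
  rw [mem_inter] at ha hb
  rw [Finset.mem_sdiff] at hc' hd'
  have hac : a ≠ c := fun e => hc'.2 (e ▸ ha.2)
  have hbc : b ≠ c := fun e => hc'.2 (e ▸ hb.2)
  have had : a ≠ d := fun e => hd'.2 (e ▸ ha.1)
  have hbd : b ≠ d := fun e => hd'.2 (e ▸ hb.1)
  have hcd : c ≠ d := fun e => hd'.2 (e ▸ hc'.1)
  have es : s = {a, b, c} := by
    rw [← sdiff_union_inter s t, hc, hi]
    ext x; simp only [mem_union, mem_insert, mem_singleton]; tauto
  have et : t = {a, b, d} := by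
    rw [← sdiff_union_inter t s, hd, inter_comm, hi]
    ext x; simp only [mem_union, mem_insert, mem_singleton]; tauto
  -- Resampling all four nodes leaves the average of a constant over families.
  rw [es, et, ← expect_update h d, ← expect_update h c, ← expect_update h b,
    ← expect_update h a, twoTriangleProb, ← expect_const (keyRingFamilies_nonempty (n := n) h)
      (𝔼 A ∈ keyRings K P, 𝔼 B ∈ keyRings K P, meet A B * _)]
  refine expect_congr rfl fun A _ => expect_congr rfl fun RA _ => expect_congr rfl fun RB _ => ?_
  -- Given the rings of the common edge, the outer nodes `c` and `d` are independent copies, hence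
  -- the square.
  rw [sq, expect_mul_expect, mul_expect]
  refine expect_congr rfl fun RC _ => ?_
  rw [mul_expect]
  refine expect_congr rfl fun RD _ => ?_
  rw [triangle_eq _ hab hac hbc, triangle_eq _ hab had hbd]
  simp only [Function.update_of_ne, Function.update_self, ne_eq, hab, hac, hbc, had, hbd, hcd,
    not_false_eq_true]
  linear_combination (meet RA RC * meet RB RC * meet RA RD * meet RB RD) * meet_mul_self RA RB

theorem triangleProb_nonneg (h : K ≤ P) : 0 ≤ triangleProb K P :=
  le_trans (pow_nonneg (sub_nonneg.2 (q_le_one h)) 3) (one_sub_q_pow_le_triangleProb h)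

theorem twoTriangleProb_nonneg : 0 ≤ twoTriangleProb K P :=
  expect_nonneg fun _ _ => expect_nonneg fun _ _ => mul_nonneg (meet_nonneg _ _) (sq_nonneg _)

/-- Such a triple arises from `s` by dropping one of its three nodes and inserting one of the n
nodes. -/
theorem card_filter_card_inter_eq_two_le {s : Finset (Fin n)} (hs : #s = 3) :
    #((powersetCard 3 univ).filter fun t => #(s ∩ t) = 2) ≤ 3 * n := by
  have : (powersetCard 3 univ).filter (fun t => #(s ∩ t) = 2) ⊆
      (s ×ˢ (univ : Finset (Fin n))).image fun p => insert p.2 (s.erase p.1) := by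
    intro t ht
    obtain ⟨ht, hst⟩ := mem_filter.1 ht
    have ht3 : #t = 3 := (mem_powersetCard.1 ht).2
    obtain ⟨c, hc⟩ := card_eq_one.1 (show #(s \ t) = 1 by
      have := card_sdiff_add_card_inter s t; omega)
    obtain ⟨d, hd⟩ := card_eq_one.1 (show #(t \ s) = 1 by
      have := card_sdiff_add_card_inter t s; rw [inter_comm] at this; omega)
    have hcs : c ∈ s \ t := by rw [hc]; simp
    refine mem_image.2 ⟨(c, d), by simpa using (Finset.mem_sdiff.1 hcs).1, ?_⟩
    have e : s.erase c = s ∩ t := by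
      rw [← sdiff_singleton_eq_erase, ← hc, sdiff_sdiff_right_self]; rfl
    rw [e]
    conv_rhs => rw [← sdiff_union_inter t s, hd, inter_comm]
    rfl
  refine (card_le_card this).trans (card_image_le.trans ?_)
  rw [card_product, hs, card_univ, Fintype.card_fin]

theorem expect_triangle_mul_triangle_le (h : K ≤ P) {s t : Finset (Fin n)}
    (hs : #s = 3) (ht : #t = 3) :
    𝔼 A ∈ keyRingFamilies n K P, triangle s A * triangle t A ≤
      triangleProb K P ^ 2 + (if s = t then triangleProb K P else 0) +
        (if #(s ∩ t) = 2 then twoTriangleProb K P else 0) := by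
  have h0 := triangleProb_nonneg h
  have h1 := twoTriangleProb_nonneg (K := K) (P := P)
  by_cases hst : s = t
  · subst hst
    simp_rw [triangle_mul_self]
    simp only [if_true, inter_self, hs, expect_triangle_eq h hs]
    norm_num
    positivity
  by_cases h2 : #(s ∩ t) = 2
  · rw [expect_triangle_mul_triangle_of_card_inter_eq_two h hs ht h2, if_pos h2, if_neg hst]
    nlinarith
  · have h3 : #(s ∩ t) ≤ 1 := by
      by_contra hlt
      have h4 : #(s ∩ t) ≤ #s := card_le_card inter_subset_left
      have h5 : s ∩ t = s := eq_of_subset_of_card_le inter_subset_left (by omega)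
      exact hst (eq_of_subset_of_card_le (inter_eq_left.1 h5) (by omega))
    rw [expect_triangle_mul_triangle_of_card_inter_le_one h hs ht h3, if_neg hst, if_neg h2]
    simp

/-- The number of triangles. -/
noncomputable def triangles (A : Fin n → Finset (Fin P)) : ℝ :=
  ∑ s ∈ powersetCard 3 univ, triangle s A

theorem expect_triangles (h : K ≤ P) :
    𝔼 A ∈ keyRingFamilies n K P, triangles A = n.choose 3 * triangleProb K P := by
  unfold triangles
  rw [expect_sum_comm, sum_congr rfl fun s hs => expect_triangle_eq h (mem_powersetCard.1 hs).2,
    sum_const, card_powersetCard, card_univ, Fintype.card_fin, nsmul_eq_mul]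

theorem expect_triangles_sq_le (h : K ≤ P) :
    𝔼 A ∈ keyRingFamilies n K P, triangles A ^ 2 ≤
      (n.choose 3 * triangleProb K P) ^ 2 + n.choose 3 * triangleProb K P +
        n.choose 3 * (3 * n) * twoTriangleProb K P := by
  unfold triangles
  simp_rw [sq, sum_mul_sum]
  rw [expect_sum_comm]
  have hcard : #(powersetCard 3 (univ : Finset (Fin n))) = n.choose 3 := by simp
  calc ∑ s ∈ powersetCard 3 univ, 𝔼 A ∈ keyRingFamilies n K P,
        ∑ t ∈ powersetCard 3 univ, triangle s A * triangle t A
      ≤ ∑ s ∈ powersetCard 3 (univ : Finset (Fin n)), (n.choose 3 * triangleProb K P ^ 2 +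
          triangleProb K P + (3 * n) * twoTriangleProb K P) := by
        refine sum_le_sum fun s hs => ?_
        rw [expect_sum_comm]
        refine (sum_le_sum fun t ht => expect_triangle_mul_triangle_le h
          (mem_powersetCard.1 hs).2 (mem_powersetCard.1 ht).2).trans ?_
        rw [sum_add_distrib, sum_add_distrib, sum_const, hcard, sum_ite_eq, if_pos hs,
          nsmul_eq_mul, ← sum_filter, sum_const, nsmul_eq_mul]
        refine add_le_add le_rfl (mul_le_mul_of_nonneg_right ?_ twoTriangleProb_nonneg)
        exact_mod_cast card_filter_card_inter_eq_two_le (mem_powersetCard.1 hs).2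
    _ = _ := by rw [sum_const, hcard, nsmul_eq_mul]; ring

open scoped Classical in
-- Chebyshev's inequality, averaged from 1{X = 0}·m² ≤ (X - m)². The product form avoids dividing by
-- a possibly zero mean m.
theorem expect_triangles_eq_zero_mul_le (h : K ≤ P) :
    (𝔼 A ∈ keyRingFamilies n K P, if triangles A = 0 then (1 : ℝ) else 0) *
        (n.choose 3 * triangleProb K P) ^ 2 ≤
      n.choose 3 * triangleProb K P + n.choose 3 * (3 * n) * twoTriangleProb K P := by
  set m : ℝ := n.choose 3 * triangleProb K P with hm
  have pt : ∀ A : Fin n → Finset (Fin P), (if triangles A = 0 then (1 : ℝ) else 0) * m ^ 2 ≤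
      triangles A ^ 2 - 2 * m * triangles A + m ^ 2 := fun A => by
    split_ifs with h0
    · rw [h0]; simp
    · nlinarith [sq_nonneg (triangles A - m)]
  rw [expect_mul]
  refine (expect_le_expect fun A _ => pt A).trans ?_
  rw [expect_add_distrib, expect_sub_distrib, ← mul_expect, expect_triangles h,
    expect_const (keyRingFamilies_nonempty h), ← hm]
  have := expect_triangles_sq_le (n := n) h
  rw [← hm] at this
  linarith

theorem triangleCount_pos_of_triangles_ne_zero {A : Fin n → Finset (Fin P)}
    (h : triangles A ≠ 0) : 0 < triangleCount (keyGraph A) := by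
  obtain ⟨s, _, hs⟩ := exists_ne_zero_of_sum_ne_zero h
  rw [triangleCount, Set.ncard_pos (Set.toFinite _)]
  refine ⟨s, ?_⟩
  by_contra hc
  exact hs (if_neg hc)

open scoped Classical in
-- Independence and uniformity give every admissible family the same mass. The event contains the
-- disjoint union of the atoms with X ≠ 0, which is enough for a lower bound.
theorem one_sub_le_measureReal_triangleEvent {Ω : Type*} [MeasurableSpace Ω] {μ : Measure Ω}
    [IsProbabilityMeasure μ] (h : K ≤ P) {ring : Fin n → Ω → Finset (Fin P)}
    (hr : IsKeyRings μ n K P ring) :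
    1 - (𝔼 A ∈ keyRingFamilies n K P, if triangles A = 0 then (1 : ℝ) else 0) ≤
      μ.real (triangleEvent ring) := by
  set G := (keyRingFamilies n K P).filter fun A => triangles A ≠ 0 with hG
  have hmeas : ∀ (i : Fin n) (S : Finset (Fin P)), MeasurableSet {ω | ring i ω = S} :=
    fun i S => hr.measurable i (MeasurableSpace.measurableSet_top (s := {S}))
  have hpt : ∀ A ∈ keyRingFamilies n K P,
      μ.real {ω | ∀ i, ring i ω = A i} = (((P.choose K : ℕ) : ℝ)⁻¹) ^ n := fun A hA => by
    have h1 := hr.indep.measure_inter_preimage_eq_mul univ (sets := fun i => {A i})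
      (fun i _ => MeasurableSpace.measurableSet_top)
    have h2 : (⋂ i ∈ (univ : Finset (Fin n)), ring i ⁻¹' {A i}) = {ω | ∀ i, ring i ω = A i} := by
      ext ω; simp
    rw [h2] at h1
    rw [measureReal_def, h1, ENNReal.toReal_prod]
    refine (prod_congr rfl fun i _ =>
      hr.uniform i (A i) (mem_powersetCard.1 (Fintype.mem_piFinset.1 hA i)).2).trans ?_
    rw [prod_const, card_univ, Fintype.card_fin]
  have hsub : (⋃ A ∈ G, {ω | ∀ i, ring i ω = A i}) ⊆ triangleEvent ring := by
    intro ω hω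
    simp only [Set.mem_iUnion, Set.mem_ofPred_eq] at hω
    obtain ⟨A, hA, hω⟩ := hω
    have e : (fun i => ring i ω) = A := funext hω
    change 0 < triangleCount (keyGraph fun i => ring i ω)
    rw [e]
    exact triangleCount_pos_of_triangles_ne_zero (mem_filter.1 hA).2
  have hle := measureReal_mono (μ := μ) hsub
  rw [measureReal_biUnion_finset ?_ ?_] at hle
  · refine le_trans (le_of_eq ?_) hle
    have hone : ∀ x : ℝ, 1 - x = (𝔼 _A ∈ keyRingFamilies n K P, (1 : ℝ)) - x := fun x => by
      rw [expect_const (keyRingFamilies_nonempty h)]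
    rw [sum_congr rfl fun A hA => hpt A (mem_filter.1 hA).1, sum_const, nsmul_eq_mul,
      hone, ← expect_sub_distrib, expect_eq_sum_div_card, Fintype.card_piFinset_const,
      card_keyRings, inv_pow, ← div_eq_mul_inv,
      Nat.cast_pow]
    congr 1
    rw [← sum_boole]
    refine sum_congr rfl fun A _ => ?_
    by_cases h0 : triangles A = 0 <;> simp [h0]
  · intro A _ B _ hAB
    refine Set.disjoint_left.2 fun ω hA hB => hAB (funext fun i => ?_)
    exact (hA i).symm.trans (hB i)
  · intro A _
    have : {ω | ∀ i, ring i ω = A i} = ⋂ i, {ω | ring i ω = A i} := by ext ω; simp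
    rw [this]
    exact MeasurableSet.iInter fun i => hmeas i _

end RandomKeyGraph

/-! ### Quantitative bounds in n, β and τ. -/

namespace RandomKeyGraph

/-- From (n-2)³/6 and n - 2 ≥ n/3; the constant is 162 = 27·6. -/
theorem cube_le_choose_three {n : ℕ} (hn : 3 ≤ n) : (n : ℝ) ^ 3 / 162 ≤ n.choose 3 := by
  refine le_trans ?_ (Nat.pow_le_choose (α := ℝ) 3 n)
  have h1 : (n : ℝ) / 3 ≤ ((n + 1 - 3 : ℕ) : ℝ) := by
    rw [Nat.cast_sub (by omega)]
    have : (3 : ℝ) ≤ n := by exact_mod_cast hn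
    push_cast
    linarith
  have h2 := pow_le_pow_left₀ (by positivity) h1 3
  rw [show ((Nat.factorial 3 : ℕ) : ℝ) = 6 by norm_num [Nat.factorial]]
  linarith [show ((n : ℝ) / 3) ^ 3 = (n : ℝ) ^ 3 / 27 by ring]

/-- The second moment bound for the existence of a triangle. -/
theorem one_sub_le_measureReal_triangleEvent_of_pos {Ω : Type*} [MeasurableSpace Ω]
    {μ : Measure Ω} [IsProbabilityMeasure μ] {n K P : ℕ} (h : K ≤ P) (hn : 3 ≤ n)
    {ring : Fin n → Ω → Finset (Fin P)} (hr : IsKeyRings μ n K P ring)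
    (hpos : 0 < triangleProb K P) :
    1 - (162 / ((n : ℝ) ^ 3 * triangleProb K P) +
        486 * twoTriangleProb K P / ((n : ℝ) ^ 2 * triangleProb K P ^ 2)) ≤
      μ.real (triangleEvent ring) := by
  refine le_trans (sub_le_sub_left ?_ 1) (one_sub_le_measureReal_triangleEvent h hr)
  have hn0 : (0 : ℝ) < n := by
    have : 0 < n := by omega
    exact_mod_cast this
  have hM := cube_le_choose_three hn
  have hM0 : (0 : ℝ) < n.choose 3 := lt_of_lt_of_le (by positivity) hM
  have hρ := twoTriangleProb_nonneg (K := K) (P := P)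
  have h1 := (le_div_iff₀ (by positivity)).2 (expect_triangles_eq_zero_mul_le (n := n) h)
  refine h1.trans ?_
  have e : (n.choose 3 * triangleProb K P + n.choose 3 * (3 * n) * twoTriangleProb K P) /
      (n.choose 3 * triangleProb K P) ^ 2 = 1 / (n.choose 3 * triangleProb K P) +
        3 * n * twoTriangleProb K P / (n.choose 3 * triangleProb K P ^ 2) := by
    field_simp
  rw [e]
  refine add_le_add ?_ ?_
  · rw [div_le_div_iff₀ (by positivity) (by positivity)]
    nlinarith [mul_le_mul_of_nonneg_right hM hpos.le]
  · rw [div_le_div_iff₀ (by positivity) (by positivity)]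
    have := mul_le_mul_of_nonneg_right hM
      (show 0 ≤ 486 * twoTriangleProb K P * triangleProb K P ^ 2 by positivity)
    linarith [show 3 * n * twoTriangleProb K P * ((n : ℝ) ^ 2 * triangleProb K P ^ 2) =
      (n : ℝ) ^ 3 / 162 * (486 * twoTriangleProb K P * triangleProb K P ^ 2) by ring]

theorem half_le_one_sub_exp_neg {x : ℝ} (h0 : 0 ≤ x) (h1 : x ≤ 1) :
    x / 2 ≤ 1 - Real.exp (-x) := by
  have h := Real.add_one_le_exp x
  have h2 : Real.exp (-x) ≤ 1 / (x + 1) := by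
    rw [Real.exp_neg, ← one_div]
    exact one_div_le_one_div_of_le (by linarith) h
  have h3 : 1 / (x + 1) ≤ 1 - x / 2 := by
    rw [div_le_iff₀ (by linarith)]
    nlinarith
  linarith

theorem one_sub_q_ge {K P : ℕ} (h : K ≤ P) (hl : (K : ℝ) ^ 2 / P ≤ 1) :
    (K : ℝ) ^ 2 / P / 2 ≤ 1 - q K P :=
  (half_le_one_sub_exp_neg (by positivity) hl).trans (sub_le_sub_left (q_le_exp h) 1)

theorem cube_div_sq_le {K P : ℕ} (hK : 1 ≤ K) :
    (K : ℝ) ^ 3 / (P : ℝ) ^ 2 ≤ ((K : ℝ) ^ 2 / P) ^ 2 := by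
  rw [div_pow, ← pow_mul]
  exact div_le_div_of_nonneg_right
    (pow_le_pow_right₀ (by exact_mod_cast hK) (by norm_num)) (by positivity)

/-- In `le_triangleProb`, (1-q)³ ≥ l³/8 for l = K²/P, while q³ ≥ 1/8 and 1 - exp(-a) ≥ a/2 for a =
K³/P² leave a/16. -/
theorem tau_le_triangleProb {K P : ℕ} (h : K ≤ P) (hK : 1 ≤ K) (hl : (K : ℝ) ^ 2 / P ≤ 1)
    (hq : 1 / 2 ≤ q K P) : tau K P / 16 ≤ triangleProb K P := by
  refine le_trans ?_ (le_triangleProb h)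
  have h1 := pow_le_pow_left₀ (by positivity) (one_sub_q_ge h hl) 3
  have ha0 : 0 ≤ (K : ℝ) ^ 3 / (P : ℝ) ^ 2 := by positivity
  have ha1 : (K : ℝ) ^ 3 / (P : ℝ) ^ 2 ≤ 1 :=
    (cube_div_sq_le hK).trans (pow_le_one₀ (by positivity) hl)
  have h2 := mul_le_mul (pow_le_pow_left₀ (by norm_num) hq 3)
    (half_le_one_sub_exp_neg ha0 ha1) (by positivity) (pow_nonneg (q_nonneg K P) 3)
  have h3 : 0 ≤ ((K : ℝ) ^ 2 / P) ^ 3 := by positivity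
  rw [tau]
  linarith [show ((K : ℝ) ^ 2 / P / 2) ^ 3 = ((K : ℝ) ^ 2 / P) ^ 3 / 8 by ring]

/-- The factor l = K²/P turns `twoTriangleProb_le` into a bound by τ², since (K/P)²l² = (K³/P²)² and
l⁵·l = (l³)². -/
theorem twoTriangleProb_mul_le {K P : ℕ} (h : K ≤ P) (hl : (K : ℝ) ^ 2 / P ≤ 1) :
    twoTriangleProb K P * ((K : ℝ) ^ 2 / P) ≤ 4 * tau K P ^ 2 := by
  have h1 := twoTriangleProb_le h
  set l : ℝ := (K : ℝ) ^ 2 / P with hl'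
  set a : ℝ := (K : ℝ) ^ 3 / (P : ℝ) ^ 2 with ha'
  have hl0 : 0 ≤ l := by positivity
  have ha0 : 0 ≤ a := by positivity
  have e : ((K : ℝ) / P) ^ 2 * l ^ 2 = a ^ 2 := by
    rw [hl', ha']
    ring
  have h2 := mul_le_mul_of_nonneg_right h1 hl0
  have h3 : a ^ 2 * l ≤ a ^ 2 := mul_le_of_le_one_right (by positivity) hl
  have h4 : 0 ≤ a * l ^ 3 := by positivity
  have h5 : 0 ≤ l ^ 6 := by positivity
  have e2 : (2 * ((K : ℝ) / P) ^ 2 * (l + l ^ 2) + 2 * l ^ 5) * l =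
      2 * a ^ 2 + 2 * (a ^ 2 * l) + 2 * l ^ 6 := by rw [← e]; ring
  have e3 : tau K P ^ 2 = a ^ 2 + 2 * (a * l ^ 3) + l ^ 6 := by
    rw [tau]; ring
  rw [e2] at h2
  rw [e3]
  linarith

theorem tau_le {K P : ℕ} (hK : 1 ≤ K) (hl : (K : ℝ) ^ 2 / P ≤ 1) :
    tau K P ≤ 2 * ((K : ℝ) ^ 2 / P) ^ 2 := by
  have h1 := cube_div_sq_le (P := P) hK
  have h2 : ((K : ℝ) ^ 2 / P) ^ 3 ≤ ((K : ℝ) ^ 2 / P) ^ 2 :=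
    pow_le_pow_of_le_one (by positivity) hl (by norm_num)
  rw [tau]
  linarith

theorem sq_div_le_one_of_exp_lt_q {K P : ℕ} (h : K ≤ P) (hq : Real.exp (-1) < q K P) :
    (K : ℝ) ^ 2 / P ≤ 1 := by
  have := Real.exp_lt_exp.1 (hq.trans_le (q_le_exp h))
  linarith

/-- The second moment bound in terms of `n³ τ(θ)` when `q(θ)` is close to one. -/
theorem one_sub_le_measureReal_triangleEvent_of_tau {Ω : Type*} [MeasurableSpace Ω]
    {μ : Measure Ω} [IsProbabilityMeasure μ] {n K P : ℕ} (h : K ≤ P) (hn : 3 ≤ n)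
    {ring : Fin n → Ω → Finset (Fin P)} (hr : IsKeyRings μ n K P ring)
    (hq : 1 / 2 ≤ q K P) (hq' : Real.exp (-1) < q K P) (ht : 1 ≤ (n : ℝ) ^ 3 * tau K P) :
    1 - (2592 / ((n : ℝ) ^ 3 * tau K P) +
        497664 / Real.sqrt ((n : ℝ) ^ 3 * tau K P / 2)) ≤ μ.real (triangleEvent ring) := by
  have hn0 : (1 : ℝ) ≤ n := by
    have : 1 ≤ n := by omega
    exact_mod_cast this
  have hK : 1 ≤ K := by
    rcases Nat.eq_zero_or_pos K with rfl | hK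
    · norm_num [tau] at ht
    · exact hK
  have hl := sq_div_le_one_of_exp_lt_q h hq'
  have hP : (0 : ℝ) < P := by
    have : 0 < P := by omega
    exact_mod_cast this
  have hl0 : 0 < (K : ℝ) ^ 2 / P := by
    have : (0 : ℝ) < K := by exact_mod_cast hK
    positivity
  have hτ : 0 < tau K P := (mul_pos_iff_of_pos_left (by positivity)).1
    (zero_lt_one.trans_le ht)
  have hβ := tau_le_triangleProb h hK hl hq
  have hβ0 : 0 < triangleProb K P := lt_of_lt_of_le (by positivity) hβ
  -- Here 2592 = 162·16 and 497664 = 486·4·16², from β ≥ τ/16 and ρl ≤ 4τ².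
  refine le_trans (sub_le_sub_left (add_le_add ?_ ?_) 1)
    (one_sub_le_measureReal_triangleEvent_of_pos h hn hr hβ0)
  · rw [div_le_div_iff₀ (by positivity) (by positivity)]
    have := mul_le_mul_of_nonneg_left hβ (show 0 ≤ 2592 * (n : ℝ) ^ 3 by positivity)
    linarith
  · have hs : Real.sqrt ((n : ℝ) ^ 3 * tau K P / 2) ≤ (n : ℝ) ^ 2 * ((K : ℝ) ^ 2 / P) := by
      refine Real.sqrt_le_iff.2 ⟨by positivity, ?_⟩
      have h1 := mul_le_mul_of_nonneg_left (tau_le hK hl) (show 0 ≤ (n : ℝ) ^ 3 by positivity)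
      have h2 : (n : ℝ) ^ 3 ≤ (n : ℝ) ^ 4 := pow_le_pow_right₀ hn0 (by norm_num)
      have h3 := mul_le_mul_of_nonneg_right h2
        (show 0 ≤ ((K : ℝ) ^ 2 / P) ^ 2 by positivity)
      linarith [show ((n : ℝ) ^ 2 * ((K : ℝ) ^ 2 / P)) ^ 2 =
        (n : ℝ) ^ 4 * ((K : ℝ) ^ 2 / P) ^ 2 by ring]
    refine le_trans ?_ (div_le_div_of_nonneg_left (by norm_num)
      (Real.sqrt_pos.2 (by positivity)) hs)
    rw [div_le_div_iff₀ (by positivity) (by positivity)]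
    have h1 := mul_le_mul_of_nonneg_left (twoTriangleProb_mul_le h hl)
      (show 0 ≤ 486 * (n : ℝ) ^ 2 by positivity)
    have h2 := mul_le_mul_of_nonneg_left (pow_le_pow_left₀ (by positivity) hβ 2)
      (show 0 ≤ 497664 * (n : ℝ) ^ 2 by positivity)
    linarith

end RandomKeyGraph

/-! ### The limit in the two cases. -/

theorem theorem2 {Ω : Type*} [MeasurableSpace Ω] (μ : Measure Ω) [IsProbabilityMeasure μ]
    (K P : ℕ → ℕ) (hscaling : RandomKeyGraph.IsScaling K P)
    (ring : ∀ n : ℕ, Fin n → Ω → Finset (Fin (P n)))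
    (hring : ∀ n : ℕ, 2 ≤ n → RandomKeyGraph.IsKeyRings μ n (K n) (P n) (ring n))
    (qstar : ℝ)
    (hq : Tendsto (fun n : ℕ => RandomKeyGraph.q (K n) (P n)) atTop (𝓝 qstar))
    (hcase : qstar < 1 ∨
      (qstar = 1 ∧
        Tendsto (fun n : ℕ => (n : ℝ) ^ 3 * RandomKeyGraph.tau (K n) (P n)) atTop atTop)) :
    Tendsto (fun n : ℕ => μ.real (RandomKeyGraph.triangleEvent (ring n))) atTop (𝓝 1) := by
  open RandomKeyGraph in
  have hle : ∀ᶠ n in atTop, μ.real (triangleEvent (ring n)) ≤ 1 :=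
    Eventually.of_forall fun n => measureReal_le_one
  rcases hcase with hlt | ⟨rfl, hτ⟩
  -- Eventually q < (1 + q⋆)/2, so 1 - q > (1 - q⋆)/2 and `c` bounds the triangle probability from
  -- below.
  · set c : ℝ := ((1 - qstar) / 2) ^ 3 with hc
    have hc0 : 0 < c := by
      have : 0 < (1 - qstar) / 2 := by linarith
      positivity
    have hlim : Tendsto (fun n : ℕ => 1 - (162 / ((n : ℝ) ^ 3 * c) + 486 / ((n : ℝ) ^ 2 * c ^ 2)))
        atTop (𝓝 (1 - (0 + 0))) := by
      have hpow : ∀ k : ℕ, k ≠ 0 → Tendsto (fun n : ℕ => (n : ℝ) ^ k) atTop atTop :=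
        fun k hk => (tendsto_pow_atTop hk).comp tendsto_natCast_atTop_atTop
      exact tendsto_const_nhds.sub
        (((hpow 3 (by norm_num)).atTop_mul_const hc0).const_div_atTop 162 |>.add
          (((hpow 2 (by norm_num)).atTop_mul_const (by positivity)).const_div_atTop 486))
    rw [add_zero, sub_zero] at hlim
    refine tendsto_of_tendsto_of_tendsto_of_le_of_le' hlim tendsto_const_nhds ?_ hle
    filter_upwards [eventually_ge_atTop 3,
      hq.eventually_lt_const (show qstar < (1 + qstar) / 2 by linarith)] with n hn hqn
    have h := hscaling n (by omega)
    have hβ : c ≤ triangleProb (K n) (P n) :=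
      (pow_le_pow_left₀ (by linarith) (by linarith) 3).trans (one_sub_q_pow_le_triangleProb h)
    refine le_trans (sub_le_sub_left (add_le_add ?_ ?_) 1)
      (one_sub_le_measureReal_triangleEvent_of_pos h hn (hring n (by omega)) (hc0.trans_le hβ))
    · gcongr
    · have := twoTriangleProb_le_one h
      refine div_le_div₀ (by norm_num) (by linarith) (by positivity) ?_
      gcongr
  · have hlim : Tendsto (fun n : ℕ => 1 - (2592 / ((n : ℝ) ^ 3 * tau (K n) (P n)) +
        497664 / Real.sqrt ((n : ℝ) ^ 3 * tau (K n) (P n) / 2))) atTop (𝓝 (1 - (0 + 0))) :=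
      tendsto_const_nhds.sub ((hτ.const_div_atTop 2592).add
        ((Real.tendsto_sqrt_atTop.comp (hτ.atTop_div_const two_pos)).const_div_atTop 497664))
    rw [add_zero, sub_zero] at hlim
    refine tendsto_of_tendsto_of_tendsto_of_le_of_le' hlim tendsto_const_nhds ?_ hle
    filter_upwards [eventually_ge_atTop 3,
      hq.eventually_const_lt (show (1 / 2 : ℝ) < 1 by norm_num),
      -- Since q ≤ exp(-K²/P), this threshold forces K²/P ≤ 1.
      hq.eventually_const_lt (show Real.exp (-1) < 1 by simp),
      hτ.eventually_ge_atTop 1] with n hn h1 h2 h3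
    exact one_sub_le_measureReal_triangleEvent_of_tau (hscaling n (by omega)) hn
      (hring n (by omega)) h1.le h2 h3
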